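/- All groups are abelian and $\operatorname{Ext}=\operatorname{Ext}^1_{\mathbb Z}$. A group $A$ is a *W-group* (Whitehead group) if $\operatorname{Ext}(A,\mathbb{Z})=0$. A *W\*-group* is a group isomorphic to the dual $B^{*}=\operatorname{Hom}(B,\mathbb{Z})$ of some W-group $B$. A *W-test group* is a group $C$ such that, for every group $A$, $A$ is a W-group if and only if $\operatorname{Ext}(A,C)=0$. For a regular uncountable cardinal $\kappa$ and $E\subseteq\kappa$, $\diamondsuit_\kappa(E)$ says that there are sets $S_\alpha\subseteq\alpha$ $(\alpha\in E)$ such that for every $X\subseteq\kappa$ the set $\{\alpha\in E: X\cap\alpha=S_\alpha\}$ is stationary in $\kappa$. Theorem 3.4. Assume $(\ddagger)$: $\diamondsuit_\kappa(E)$ holds for every regular cardinal $\kappa>\aleph_1$ and every stationary subset $E$ of $\kappa$. Assume also that the tensor product of any two W-groups of cardinality $\le\aleph_1$ is a W-group. Then the tensor product of any two W-groups (of arbitrary cardinality) is a W-group. Consequently, under the same assumptions, every non-zero W\*-group is a W-test group. -/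

import Mathlib

open CategoryTheory Cardinal
open scoped TensorProduct

universe u

/-- `Ext(A, C) = 0`, where `Ext = Ext¹_ℤ` is computed in the category of abelian groups
(`ℤ`-modules). -/
def ExtVanishes (A C : Type u) [AddCommGroup A] [AddCommGroup C] : Prop :=
  Subsingleton (Abelian.Ext (ModuleCat.of ℤ A) (ModuleCat.of ℤ C) 1)

/-- A W-group (Whitehead group): an abelian group `A` with `Ext(A, ℤ) = 0`.
(`ULift` only moves `ℤ` to the universe of `A`.) -/
def IsWGroup (A : Type u) [AddCommGroup A] : Prop :=
  ExtVanishes A (ULift.{u} ℤ)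

/-- A W*-group: a group isomorphic to the dual `B* = Hom(B, ℤ)` of a W-group `B`. -/
def IsWStarGroup (C : Type u) [AddCommGroup C] : Prop :=
  ∃ (B : Type u) (_ : AddCommGroup B), IsWGroup B ∧ Nonempty (C ≃+ (B →+ ℤ))

/-- A W-test group: a group `C` such that the groups `A` with `Ext(A, C) = 0` are exactly the
W-groups. -/
def IsWTestGroup (C : Type u) [AddCommGroup C] : Prop :=
  ∀ (A : Type u) [AddCommGroup A], IsWGroup A ↔ ExtVanishes A C

/-- The diamond principle `◇_κ(E)` for `E ⊆ κ`: there are sets `S α ⊆ α` (`α ∈ E`) such that for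
every `X ⊆ κ` the set of all `α ∈ E` with `X ∩ α = S α` is stationary in `κ`. The cardinal `κ` is
represented by the well-ordered type `κ.ord.ToType` of order type `κ`, in which the ordinal `α`
is the initial segment `Set.Iio α`. -/
def DiamondPrinciple (κ : Cardinal.{u}) (E : Set κ.ord.ToType) : Prop :=
  ∃ S : κ.ord.ToType → Set κ.ord.ToType,
    (∀ α ∈ E, S α ⊆ Set.Iio α) ∧
      ∀ X : Set κ.ord.ToType, IsStationary {α | α ∈ E ∧ X ∩ Set.Iio α = S α}

/-! ### Lifting problems relative to subgroups, and Eklof's lemma -/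

section Lifting

variable {A X Y I J : Type*} [AddCommGroup A] [AddCommGroup X] [AddCommGroup Y]
  [AddCommGroup I] [AddCommGroup J]

/-! For an exact sequence 0 → D → I → J → 0 with I injective, Ext(X, D) = 0 means that every map X →
J lifts to I (`extVanishes_iff_lifts`). If B is a W-group, then 0 → B* → Hom(B, ℚ) → Hom(B, ℚ/ℤ) → 0
is such a sequence, and tensor-hom adjunction shows that Ext(A, B*) = 0 exactly when A ⊗ B is a
W-group. With B fixed this is a lifting condition on A with injective source, so it passes up
filtrations by Eklof's lemma (`LiftsOver.iSup`).

It remains to decompose W-groups. Every W-group of size above ℵ₁ is the union of a well-ordered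
chain of smaller subgroups whose successive quotients are W-groups. In regular cardinality, diamond
predicts lifts: were the bad quotients stationary, a map to ℚ/ℤ could be built that defeats every
predicted lift (`Lifts.not_isStationary`). In singular cardinality a Shelah-style compactness
argument is used (`Lifts.hasFiltration_of_isSingular`). It needs Hill maps on smaller W-groups:
closure under such a map guarantees that the quotient is a W-group.

Induction on cardinality then reduces one tensor factor to size at most ℵ₁ (`Lifts.of_small`); doing
this to each factor in turn gives the tensor product theorem. For the converse half of the test
property, a non-zero dual makes ℤ a summand of B, and hence A a summand of A ⊗ B. -/

theorem AddMonoidHom.exists_comp_eq_of_surjective (φ : X →+ Y) (hφ : Function.Surjective φ)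
    (g : X →+ I) (h : ∀ x, φ x = 0 → g x = 0) : ∃ k : Y →+ I, ∀ x, k (φ x) = g x :=
  ⟨φ.liftOfSurjective hφ ⟨g, fun x hx => h x hx⟩,
    fun x => AddMonoidHom.liftOfRightInverse_comp_apply φ _ _ ⟨g, fun x hx => h x hx⟩ x⟩

theorem Module.Baer.exists_comp_eq (hI : Module.Baer ℤ I) (φ : X →+ Y)
    (g : X →+ I) (h : ∀ x, φ x = 0 → g x = 0) : ∃ k : Y →+ I, ∀ x, k (φ x) = g x := by
  obtain ⟨k, hk⟩ := AddMonoidHom.exists_comp_eq_of_surjective φ.rangeRestrict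
    φ.rangeRestrict_surjective g (fun x hx => h x (congrArg Subtype.val hx))
  obtain ⟨m, hm⟩ := hI.extension_property_addMonoidHom φ.range.subtype
    φ.range.subtype_injective k
  refine ⟨m, fun x => ?_⟩
  rw [← hk, ← hm]
  rfl

/-- Every homomorphism from `A` to `J` factors through `q : I →+ J`. -/
def Lifts (q : I →+ J) (A : Type*) [AddCommGroup A] : Prop :=
  ∀ χ : A →+ J, ∃ g : A →+ I, ∀ x, q (g x) = χ x

/-- The relative version of `Lifts` for the quotient `(M + N) / N` of subgroups of `A`. -/
def LiftsOver (q : I →+ J) (N M : AddSubgroup A) : Prop :=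
  ∀ χ : A →+ J, (∀ x ∈ N, χ x = 0) →
    ∃ g : A →+ I, (∀ x ∈ N, g x = 0) ∧ ∀ x ∈ M, q (g x) = χ x

variable {q : I →+ J} {N M L : AddSubgroup A}

theorem lifts_iff_liftsOver : Lifts q A ↔ LiftsOver q (⊥ : AddSubgroup A) ⊤ := by
  constructor
  · intro h χ _
    obtain ⟨g, hg⟩ := h χ
    exact ⟨g, fun x hx => by rw [AddSubgroup.mem_bot.1 hx, map_zero], fun x _ => hg x⟩
  · intro h χ
    obtain ⟨g, -, hg⟩ := h χ (fun x hx => by rw [AddSubgroup.mem_bot.1 hx, map_zero])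
    exact ⟨g, fun x => hg x trivial⟩

theorem LiftsOver.mono (h : LiftsOver q N M) {M' : AddSubgroup A} (hM : M' ≤ M) :
    LiftsOver q N M' := fun χ hχ =>
  let ⟨g, h1, h2⟩ := h χ hχ
  ⟨g, h1, fun x hx => h2 x (hM hx)⟩

theorem LiftsOver.of_le (h : M ≤ N) : LiftsOver q N M := fun χ hχ =>
  ⟨0, fun _ _ => rfl, fun x hx => by rw [hχ x (h hx)]; simp⟩

/-- Since `N ≤ M`, the modular law gives (L + N) ∩ M = N + (L ∩ M), so both quotients of `M` agree.
Injectivity of `I` extends the lift from `M` to `A` so that it kills `L`. -/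
theorem LiftsOver.sup_of_sup_inf (hI : Module.Baer ℤ I) (hN : N ≤ M)
    (h : LiftsOver q (N ⊔ L ⊓ M) M) : LiftsOver q (L ⊔ N) M := by
  intro χ hχ
  obtain ⟨g, h1, h2⟩ := h χ fun x hx => hχ x
    ((sup_le le_sup_right (inf_le_left.trans le_sup_left) : N ⊔ L ⊓ M ≤ L ⊔ N) hx)
  obtain ⟨k, hk⟩ := hI.exists_comp_eq ((QuotientAddGroup.mk' L).comp M.subtype)
    (g.comp M.subtype) (fun x hx => h1 x <| (le_sup_right : _ ≤ N ⊔ L ⊓ M)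
      ⟨(QuotientAddGroup.eq_zero_iff (x : A)).1 hx, x.2⟩)
  have hkM : ∀ x ∈ M, k (QuotientAddGroup.mk' L x) = g x := fun x hx => hk ⟨x, hx⟩
  refine ⟨k.comp (QuotientAddGroup.mk' L), ?_, fun x hx => ?_⟩
  · have : L ⊔ N ≤ (k.comp (QuotientAddGroup.mk' L)).ker := by
      refine sup_le (fun x hx => ?_) (fun x hx => ?_)
      · have : (QuotientAddGroup.mk' L) x = 0 := (QuotientAddGroup.eq_zero_iff x).2 hx
        simp [AddMonoidHom.mem_ker, (QuotientAddGroup.eq_zero_iff x).2 hx]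
      · exact (hkM x (hN hx)).trans (h1 x ((le_sup_left : N ≤ _) hx))
    exact fun x hx => this hx
  · exact (congrArg q (hkM x hx)).trans (h2 x hx)

/-- Lifting over a quotient of `M`, pulled back along `M → X`. -/
theorem LiftsOver.of_surjective (hI : Module.Baer ℤ I) (π : M →+ X)
    (hπ : Function.Surjective π) {K : AddSubgroup X} (hK : LiftsOver q K ⊤)
    (hN : N ≤ M) (hNK : ∀ x : M, (x : A) ∈ N ↔ π x ∈ K) : LiftsOver q N M := by
  intro χ hχ
  obtain ⟨θ, hθ⟩ := π.exists_comp_eq_of_surjective hπ (χ.comp M.subtype)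
    (fun x hx => hχ x ((hNK x).2 (hx ▸ K.zero_mem)))
  obtain ⟨g, h1, h2⟩ := hK θ (fun y hy => by
    obtain ⟨x, rfl⟩ := hπ y
    exact (hθ x).trans (hχ x ((hNK x).2 hy)))
  obtain ⟨k, hk⟩ := hI.exists_comp_eq M.subtype (g.comp π)
    (fun x hx => by
      have : x = 0 := Subtype.ext hx
      simp [this])
  refine ⟨k, fun x hx => ?_, fun x hx => ?_⟩
  · exact (hk ⟨x, hN hx⟩).trans (h1 _ ((hNK _).1 hx))
  · exact ((congrArg q (hk ⟨x, hx⟩)).trans (h2 _ trivial)).trans (hθ ⟨x, hx⟩)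

/-- Injectivity of `I` extends lifts from `M` to `A`. The converse below has to extend the target
map instead, and so needs `J` injective. -/
theorem LiftsOver.of_lifts_quotient (hI : Module.Baer ℤ I) (hN : N ≤ M)
    (h : Lifts q (M ⧸ N.addSubgroupOf M)) : LiftsOver q N M :=
  LiftsOver.of_surjective hI (QuotientAddGroup.mk' (N.addSubgroupOf M))
    (QuotientAddGroup.mk'_surjective _) (lifts_iff_liftsOver.1 h) hN fun x => by
      rw [AddSubgroup.mem_bot]
      exact ((QuotientAddGroup.eq_zero_iff x).trans AddSubgroup.mem_addSubgroupOf).symm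

theorem LiftsOver.lifts_quotient (hJ : Module.Baer ℤ J) (h : LiftsOver q N M) :
    Lifts q (M ⧸ N.addSubgroupOf M) := by
  intro θ
  obtain ⟨k, hk⟩ := hJ.exists_comp_eq ((QuotientAddGroup.mk' N).comp M.subtype)
    (θ.comp (QuotientAddGroup.mk' (N.addSubgroupOf M))) (fun x hx => by
      have : QuotientAddGroup.mk' (N.addSubgroupOf M) x = 0 :=
        (QuotientAddGroup.eq_zero_iff x).2 ((QuotientAddGroup.eq_zero_iff (x : A)).1 hx)
      simp only [AddMonoidHom.comp_apply, this, map_zero])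
  obtain ⟨g, h1, h2⟩ := h (k.comp (QuotientAddGroup.mk' N)) (fun x hx => by
    simp [(QuotientAddGroup.eq_zero_iff x).2 hx])
  obtain ⟨m, hm⟩ := (QuotientAddGroup.mk' (N.addSubgroupOf M)).exists_comp_eq_of_surjective
    (QuotientAddGroup.mk'_surjective _) (g.comp M.subtype)
    (fun x hx => h1 x ((QuotientAddGroup.eq_zero_iff x).1 hx))
  refine ⟨m, fun y => ?_⟩
  obtain ⟨x, rfl⟩ := QuotientAddGroup.mk'_surjective _ y
  exact ((congrArg q (hm x)).trans (h2 x x.2)).trans (hk x)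

/-- Coherent homomorphisms on a chain of subgroups glue to a homomorphism on the whole group. -/
theorem Module.Baer.exists_glue (hI : Module.Baer ℤ I) {ι : Type*} [LinearOrder ι]
    {D : ι → AddSubgroup A} (hD : Monotone D) (f : ι → A →+ I)
    (hf : ∀ i j, j ≤ i → ∀ x ∈ D j, f i x = f j x) :
    ∃ g : A →+ I, ∀ i, ∀ x ∈ D i, g x = f i x := by
  cases isEmpty_or_nonempty ι
  · exact ⟨0, fun i => isEmptyElim i⟩
  have hmem : ∀ x : (⨆ i, D i : AddSubgroup A), ∃ i, (x : A) ∈ D i := fun x =>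
    (AddSubgroup.mem_iSup_of_directed hD.directed_le).1 x.2
  choose s hs using hmem
  have key : ∀ i j, ∀ x ∈ D i, x ∈ D j → f i x = f j x := fun i j x hi hj => by
    rcases le_total i j with h | h
    · exact (hf j i h x hi).symm
    · exact hf i j h x hj
  let k : (⨆ i, D i : AddSubgroup A) →+ I := AddMonoidHom.mk' (fun x => f (s x) x) fun x y => by
    let m := max (s x) (max (s y) (s (x + y)))
    have hx := hD (le_max_left _ _ : s x ≤ m) (hs x)
    have hy := hD ((le_max_left _ _).trans (le_max_right _ _) : s y ≤ m) (hs y)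
    rw [key _ m _ (hs (x + y)) (by simpa using add_mem hx hy), key _ m _ (hs x) hx,
      key _ m _ (hs y) hy]
    exact map_add _ _ _
  obtain ⟨g, hg⟩ := hI.exists_comp_eq (⨆ i, D i : AddSubgroup A).subtype k (fun x hx => by
    have : x = 0 := Subtype.ext hx
    simp [this])
  refine ⟨g, fun i x hx => ?_⟩
  have hxm : x ∈ ⨆ i, D i := (le_iSup D i) hx
  exact (hg ⟨x, hxm⟩).trans (key _ _ _ (hs ⟨x, hxm⟩) hx)

/-- Transfinite construction of a homomorphism with prescribed local properties. -/
theorem Module.Baer.exists_coherent (hI : Module.Baer ℤ I) {ι : Type*} [LinearOrder ι]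
    [WellFoundedLT ι] {D : ι → AddSubgroup A} (hD : Monotone D) (Q : ι → (A →+ I) → Prop)
    (hQ : ∀ i f f', (∀ x ∈ D i, f x = f' x) → Q i f → Q i f')
    (step : ∀ i f, (∀ j < i, Q j f) → ∃ f', (∀ j < i, ∀ x ∈ D j, f' x = f x) ∧ Q i f') :
    ∃ f, ∀ i, Q i f := by
  classical
  -- The default 0 is never reached: `hF` shows inductively that a suitable extension always exists.
  let F : ι → A →+ I := WellFoundedLT.fix (motive := fun _ : ι => A →+ I) fun i F =>
    if h : ∃ f' : A →+ I, (∀ j (hj : j < i), ∀ x ∈ D j, f' x = F j hj x) ∧ Q i f' then h.choose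
    else 0
  have hF : ∀ i, (∀ j < i, ∀ x ∈ D j, F i x = F j x) ∧ Q i (F i) := by
    intro i
    induction i using WellFoundedLT.induction with
    | ind i ih =>
      have h : ∃ f' : A →+ I, (∀ j (_ : j < i), ∀ x ∈ D j, f' x = F j x) ∧ Q i f' := by
        obtain ⟨g, hg⟩ := hI.exists_glue (ι := {j // j < i}) (D := fun j => D j)
          (fun j k h => hD h) (fun j => F j) (fun j k hkj x hx => by
            rcases hkj.eq_or_lt with h | h
            · rw [h]
            · exact (ih j j.2).1 k h x hx)
        obtain ⟨f', h1, h2⟩ := step i g fun j hj =>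
          hQ j (F j) g (fun x hx => (hg ⟨j, hj⟩ x hx).symm) (ih j hj).2
        exact ⟨f', fun j hj x hx => (h1 j hj x hx).trans (hg ⟨j, hj⟩ x hx), h2⟩
      have e : F i = h.choose := by
        exact (WellFoundedLT.fix_eq _ i).trans (dif_pos h)
      rw [e]
      exact h.choose_spec
  obtain ⟨g, hg⟩ := hI.exists_glue hD F (fun i j hji x hx => by
    rcases hji.eq_or_lt with h | h
    · rw [h]
    · exact (hF i).1 j h x hx)
  exact ⟨g, fun i => hQ i (F i) g (fun x hx => (hg i x hx).symm) (hF i).2⟩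

theorem AddSubgroup.mem_iSup_lt_iff {ι : Type*} [LinearOrder ι] {F : ι → AddSubgroup A}
    (hF : Monotone F) {i : ι} (hi : ∃ j, j < i) {x : A} :
    x ∈ ⨆ j, ⨆ _ : j < i, F j ↔ ∃ j < i, x ∈ F j := by
  obtain ⟨j, hj⟩ := hi
  have : Nonempty {j // j < i} := ⟨⟨j, hj⟩⟩
  rw [iSup_subtype', AddSubgroup.mem_iSup_of_directed (K := fun k : {j // j < i} => F k)
    (fun a b => ⟨max a b, hF (le_max_left a b), hF (le_max_right a b)⟩)]
  simp

/-- Eklof's lemma: a group filtered by lifting quotients lifts. -/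
theorem LiftsOver.iSup (hI : Module.Baer ℤ I) {ι : Type*} [LinearOrder ι] [WellFoundedLT ι]
    {F : ι → AddSubgroup A} (hF : Monotone F)
    (h : ∀ i, LiftsOver q (L ⊔ ⨆ j, ⨆ _ : j < i, F j) (F i)) : LiftsOver q L (⨆ i, F i) := by
  intro χ hχ
  cases isEmpty_or_nonempty ι
  · exact ⟨0, fun _ _ => rfl, fun x hx => by
      rw [iSup_of_empty, AddSubgroup.mem_bot] at hx; simp [hx]⟩
  obtain ⟨g, hg⟩ := hI.exists_coherent (D := fun i => L ⊔ F i)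
    (fun i j hij => sup_le_sup_left (hF hij) L)
    (fun i g => (∀ x ∈ L, g x = 0) ∧ ∀ x ∈ F i, q (g x) = χ x)
    (fun i f f' hf hQ => ⟨fun x hx => (hf x ((le_sup_left : L ≤ _) hx)).symm.trans (hQ.1 x hx),
      fun x hx => by rw [← hf x ((le_sup_right : F i ≤ L ⊔ F i) hx), hQ.2 x hx]⟩)
    (fun i f hf => by
      have key : ∀ f : A →+ I, (∀ x ∈ L, f x = 0) → (∀ j < i, ∀ x ∈ F j, q (f x) = χ x) →
          ∃ f' : A →+ I, (∀ j < i, ∀ x ∈ L ⊔ F j, f' x = f x) ∧ (∀ x ∈ L, f' x = 0) ∧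
            ∀ x ∈ F i, q (f' x) = χ x := by
        intro f h1 h2
        -- The error `χ - q ∘ f` vanishes on everything treated so far, so it lifts over stage `i`;
        -- adding that lift corrects `f`.
        have hle : L ⊔ ⨆ j, ⨆ _ : j < i, F j ≤ (χ - q.comp f).ker :=
          sup_le (fun x hx => by simp [AddMonoidHom.mem_ker, h1 x hx, hχ x hx])
            (iSup₂_le fun j hj x hx => by simp [AddMonoidHom.mem_ker, h2 j hj x hx])
        obtain ⟨g, h3, h4⟩ := h i _ hle
        refine ⟨f + g, fun j hj x hx => ?_, fun x hx => ?_, fun x hx => ?_⟩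
        · simp [h3 x (sup_le_sup_left (le_iSup₂_of_le j hj le_rfl) L hx)]
        · simp [h3 x ((le_sup_left : L ≤ _) hx), h1 x hx]
        · simp [h4 x hx]
      -- At the least index nothing makes `f` vanish on `L`, so the construction restarts from 0.
      by_cases hi : ∃ j, j < i
      · obtain ⟨j, hj⟩ := hi
        exact key f (hf j hj).1 (fun k hk => (hf k hk).2)
      · have hi' : ∀ j, ¬ j < i := fun j hj => hi ⟨j, hj⟩
        obtain ⟨f', -, h2⟩ := key 0 (fun _ _ => rfl) (fun j hj => (hi' j hj).elim)
        exact ⟨f', fun j hj => (hi' j hj).elim, h2⟩)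
  refine ⟨g, (hg (Classical.arbitrary ι)).1, fun x hx => ?_⟩
  obtain ⟨i, hi⟩ := (AddSubgroup.mem_iSup_of_directed hF.directed_le).1 hx
  exact (hg i).2 x hi

/-- For a continuous chain, lifting over each earlier member gives lifting over their union. -/
theorem LiftsOver.of_continuous {ι : Type*} [LinearOrder ι] {F : ι → AddSubgroup A}
    (hF : Monotone F) (i : ι)
    (hlim : (∃ j, j < i) → (∀ j < i, ∃ k < i, j < k) → F i ≤ ⨆ j, ⨆ _ : j < i, F j)
    (h0 : LiftsOver q ⊥ (F i)) (h : ∀ j < i, LiftsOver q (F j) (F i)) :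
    LiftsOver q (⨆ j, ⨆ _ : j < i, F j) (F i) := by
  by_cases hi : ∃ j, j < i
  · by_cases hl : ∀ j < i, ∃ k < i, j < k
    · exact LiftsOver.of_le (hlim hi hl)
    · push Not at hl
      obtain ⟨j, hj, hl⟩ := hl
      have : ⨆ j, ⨆ _ : j < i, F j = F j :=
        le_antisymm (iSup₂_le fun k hk => hF (hl k hk)) (le_iSup₂_of_le j hj le_rfl)
      rw [this]
      exact h j hj
  · have : ⨆ j, ⨆ _ : j < i, F j = ⊥ := by
      rw [eq_bot_iff]
      exact iSup₂_le fun k hk => (hi ⟨k, hk⟩).elim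
    rwa [this]

end Lifting

/-! ### Sizes of generated subgroups -/

section Cardinality

variable {A : Type u} [AddCommGroup A]

theorem AddSubgroup.mk_closure_le (s : Set A) : #(AddSubgroup.closure s) ≤ max ℵ₀ #s := by
  let t : Set A := s ∪ Neg.neg '' s
  let f : List t → A := fun l => (l.map Subtype.val).sum
  have hsub : (AddSubgroup.closure s : Set A) ⊆ Set.range f := by
    intro x hx
    rw [← AddSubgroup.coe_toAddSubmonoid, AddSubgroup.closure_toAddSubmonoid] at hx
    obtain ⟨l, hl, rfl⟩ := AddSubmonoid.exists_list_of_mem_closure hx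
    have : ∀ y ∈ l, y ∈ t := fun y hy => (hl y hy).imp id fun h => ⟨-y, h, neg_neg y⟩
    exact ⟨l.attach.map fun y => ⟨y.1, this y.1 y.2⟩, by
      simp only [f, List.map_map]
      exact congrArg List.sum (List.attach_map_subtype_val l)⟩
  have ht : #t ≤ max ℵ₀ #s :=
    (mk_union_le _ _).trans <| (add_le_max _ _).trans <|
      max_le (max_le (le_max_right _ _) (mk_image_le.trans (le_max_right _ _))) (le_max_left _ _)
  exact (mk_le_mk_of_subset hsub).trans <| mk_range_le.trans <| (mk_list_le_max _).trans <|
    max_le (le_max_left _ _) ht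

theorem AddSubgroup.mk_closure_lt {κ : Cardinal.{u}} (hκ : ℵ₀ < κ) {s : Set A} (hs : #s < κ) :
    #(AddSubgroup.closure s) < κ :=
  (AddSubgroup.mk_closure_le s).trans_lt (max_lt hκ hs)

theorem AddSubgroup.mk_closure_le_of_le {κ : Cardinal.{u}} (hκ : ℵ₀ ≤ κ) {s : Set A}
    (hs : #s ≤ κ) : #(AddSubgroup.closure s) ≤ κ :=
  (AddSubgroup.mk_closure_le s).trans (max_le hκ hs)

theorem AddSubgroup.mk_sup_lt {κ : Cardinal.{u}} (hκ : ℵ₀ < κ) {M N : AddSubgroup A}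
    (hM : #M < κ) (hN : #N < κ) : #(M ⊔ N : AddSubgroup A) < κ := by
  rw [← AddSubgroup.closure_eq M, ← AddSubgroup.closure_eq N, ← AddSubgroup.closure_union]
  exact AddSubgroup.mk_closure_lt hκ ((mk_union_le _ _).trans_lt (add_lt_of_lt hκ.le hM hN))

theorem AddSubgroup.mk_sup_le {κ : Cardinal.{u}} (hκ : ℵ₀ ≤ κ) {M N : AddSubgroup A}
    (hM : #M ≤ κ) (hN : #N ≤ κ) : #(M ⊔ N : AddSubgroup A) ≤ κ := by
  rw [← AddSubgroup.closure_eq M, ← AddSubgroup.closure_eq N, ← AddSubgroup.closure_union]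
  exact AddSubgroup.mk_closure_le_of_le hκ ((mk_union_le _ _).trans (add_le_of_le hκ hM hN))

theorem AddSubgroup.mk_bot_lt {κ : Cardinal.{u}} (hκ : ℵ₀ < κ) : #(⊥ : AddSubgroup A) < κ :=
  (mk_le_aleph0 (α := (⊥ : AddSubgroup A))).trans_lt hκ

theorem AddSubgroup.mk_iSup_lt {κ : Cardinal.{u}} (hr : κ.IsRegular) (hκ : ℵ₀ < κ) {ι : Type u}
    (hι : #ι < κ) {D : ι → AddSubgroup A} (hD : ∀ i, #(D i) < κ) :
    #(⨆ i, D i : AddSubgroup A) < κ := by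
  rw [AddSubgroup.iSup_eq_closure]
  exact AddSubgroup.mk_closure_lt hκ ((card_iUnion_lt_iff_forall_of_isRegular hr hι).2 hD)

theorem AddSubgroup.mk_iSup_le {κ : Cardinal.{u}} (hκ : ℵ₀ ≤ κ) {ι : Type u}
    (hι : #ι ≤ κ) {D : ι → AddSubgroup A} (hD : ∀ i, #(D i) ≤ κ) :
    #(⨆ i, D i : AddSubgroup A) ≤ κ := by
  rw [AddSubgroup.iSup_eq_closure]
  exact AddSubgroup.mk_closure_le_of_le hκ <| (mk_iUnion_le_sum_mk).trans <|
    (Cardinal.sum_le_sum _ (fun _ => κ) hD).trans <| by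
      simpa using mul_le_of_le hκ hι le_rfl

end Cardinality

/-! ### Closure points in a regular cardinal -/

section Clubs

variable {κ : Cardinal.{u}}

theorem Cardinal.IsRegular.exists_forall_lt (hr : κ.IsRegular) {s : Set κ.ord.ToType}
    (hs : #s < κ) : ∃ b, ∀ x ∈ s, x < b := by
  rw [← not_isCofinal_iff]
  intro h
  have := Order.cof_le h
  rw [Ordinal.cof_toType, hr.cof_ord] at this
  exact this.not_gt hs

theorem Cardinal.mk_Iio_toType_lt (i : κ.ord.ToType) : #(Set.Iio i) < κ := by
  simpa using Cardinal.mk_Iio_lt i (by simp)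

/-- The set of closure points of a set-valued function with small values is a club. -/
theorem Cardinal.IsRegular.isClub_closurePoints (hr : κ.IsRegular) (hκ : ℵ₀ < κ)
    {f : κ.ord.ToType → Set κ.ord.ToType} (hf : ∀ j, #(f j) < κ) :
    IsClub {i | (∃ j, j < i) ∧ ∀ j < i, ∀ x ∈ f j, x < i} := by
  constructor
  · rintro s hs ⟨i, hi⟩ - a ha
    obtain ⟨⟨j, hj⟩, -⟩ := hs hi
    refine ⟨⟨j, hj.trans_le (ha.1 hi)⟩, fun k hk x hx => ?_⟩
    obtain ⟨m, hm, hkm⟩ := (lt_isLUB_iff ha).1 hk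
    exact ((hs hm).2 k hkm x hx).trans_le (ha.1 hm)
  · intro a
    have hstep : ∀ c : κ.ord.ToType, ∃ b, c < b ∧ ∀ j ≤ c, ∀ x ∈ f j, x < b := by
      intro c
      obtain ⟨b, hb⟩ := hr.exists_forall_lt (s := {c} ∪ ⋃ j : Set.Iic c, f j) <| by
        refine (mk_union_le _ _).trans_lt (add_lt_of_lt hκ.le ?_ ?_)
        · rw [mk_singleton]; exact one_lt_aleph0.trans hκ
        · refine (card_iUnion_lt_iff_forall_of_isRegular hr ?_).2 fun j => hf j
          rw [← Set.Iio_insert]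
          exact (mk_insert_le).trans_lt
            (add_lt_of_lt hκ.le (mk_Iio_toType_lt c) (one_lt_aleph0.trans hκ))
      exact ⟨b, hb c (Or.inl rfl), fun j hj x hx =>
        hb x (Or.inr (Set.mem_iUnion.2 ⟨⟨j, hj⟩, hx⟩))⟩
    choose g hg1 hg2 using hstep
    -- Close off ω times: any `j` below the supremum lies below some `s n`, and then `f j` lies
    -- below `s (n + 1)`.
    let s : ℕ → κ.ord.ToType := fun n => g^[n] a
    have hs : ∀ n, s (n + 1) = g (s n) := fun n => Function.iterate_succ_apply' g n a
    obtain ⟨b, hb⟩ := hr.exists_forall_lt (s := Set.range s)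
      ((Set.countable_range s).le_aleph0.trans_lt hκ)
    have hne : (upperBounds (Set.range s)).Nonempty := ⟨b, fun x hx => (hb x hx).le⟩
    obtain ⟨c, hc1, hc2⟩ := (wellFounded_lt (α := κ.ord.ToType)).has_min _ hne
    have hc : IsLUB (Set.range s) c := ⟨hc1, fun x hx => not_lt.1 (hc2 x hx)⟩
    have hsc : ∀ n, s n < c := fun n =>
      ((hg1 (s n)).trans_eq (hs n).symm).trans_le (hc.1 ⟨n + 1, rfl⟩)
    refine ⟨c, ⟨⟨a, hsc 0⟩, fun j hj x hx => ?_⟩, (hsc 0).le⟩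
    obtain ⟨_, ⟨n, rfl⟩, hn⟩ := (lt_isLUB_iff hc).1 hj
    exact ((hg2 (s n) j hn.le x hx).trans_eq (hs n).symm).trans (hsc (n + 1))

end Clubs

/-- The group `ℚ / ℤ`. -/
abbrev RatModInt : Type := ℚ ⧸ (Int.castAddHom ℚ).range

/-- The projection of `ℚ` onto `ℚ / ℤ`. -/
abbrev ratMk : ℚ →+ RatModInt := QuotientAddGroup.mk' _

theorem baer_rat : Module.Baer ℤ ℚ := Module.Baer.of_divisible ℚ

theorem baer_ratModInt : Module.Baer ℤ RatModInt :=
  letI : DivisibleBy RatModInt ℤ := Function.Surjective.divisibleBy ratMk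
    (QuotientAddGroup.mk'_surjective _) fun a n => map_zsmul ratMk n a
  Module.Baer.of_divisible RatModInt

theorem Lifts.liftsOver_bot {A : Type u} [AddCommGroup A] (hA : Lifts ratMk A)
    (M : AddSubgroup A) : LiftsOver ratMk ⊥ M :=
  (lifts_iff_liftsOver.1 hA).mono le_top

/-! ### Diamond and chains in regular cardinals -/

section Diamond

variable {A : Type u} [AddCommGroup A] {κ : Cardinal.{u}}

/-- Under the diamond principle, a chain of subgroups of a Whitehead group has non-Whitehead
successor quotients only on a non-stationary set. -/
theorem Lifts.not_isStationary (hr : κ.IsRegular) (hκ : ℵ₀ < κ)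
    (hd : ∀ E : Set κ.ord.ToType, IsStationary E → DiamondPrinciple κ E) (hA : Lifts ratMk A)
    {B : κ.ord.ToType → AddSubgroup A} (hB : Monotone B) (hBκ : ∀ i, #(B i) < κ) :
    ¬ IsStationary {i | ¬ LiftsOver ratMk (⨆ j, ⨆ _ : j < i, B j) (B i)} := by
  intro hE
  set E := {i | ¬ LiftsOver ratMk (⨆ j, ⨆ _ : j < i, B j) (B i)} with hEdef
  obtain ⟨S, -, hS⟩ := hd E hE
  let U : Set A := ⋃ i, (B i : Set A)
  have hUκ : #(U × ℚ) ≤ #κ.ord.ToType := by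
    have h1 : #U ≤ κ := (mk_iUnion_le_sum_mk).trans <|
      (Cardinal.sum_le_sum _ (fun _ => κ) fun i => (hBκ i).le).trans <| by
        simpa using mul_le_of_le hκ.le le_rfl le_rfl
    rw [mk_ord_toType, mk_prod]
    simpa using mul_le_of_le hκ.le h1 hκ.le
  obtain ⟨code⟩ := Cardinal.le_def _ _ |>.1 hUκ
  -- The relation guessed by diamond at `i`, decoded as a candidate graph of a map to ℚ.
  let G : κ.ord.ToType → A → ℚ → Prop := fun i a r => ∃ h : a ∈ U, code (⟨a, h⟩, r) ∈ S i
  have hle : ∀ i, ⨆ j, ⨆ _ : j < i, B j ≤ B i := fun i => iSup₂_le fun j hj => hB hj.le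
  obtain ⟨χ, hχ⟩ := baer_ratModInt.exists_coherent hB
    (fun i χ => i ∈ E → ¬ ∃ h : A →+ ℚ, (∀ a ∈ ⨆ j, ⨆ _ : j < i, B j, ∀ r, G i a r ↔ r = h a) ∧
      ∀ x ∈ B i, ratMk (h x) = χ x)
    (fun i f f' hf hQ hi ⟨h, h1, h2⟩ => hQ hi ⟨h, h1, fun x hx => (h2 x hx).trans (hf x hx).symm⟩)
    (fun i f _ => by
      by_cases hi : i ∈ E ∧ ∃ h : A →+ ℚ, (∀ a ∈ ⨆ j, ⨆ _ : j < i, B j, ∀ r, G i a r ↔ r = h a) ∧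
          ∀ x ∈ ⨆ j, ⨆ _ : j < i, B j, ratMk (h x) = f x
      · obtain ⟨hiE, h0, h1, h2⟩ := hi
        have hno : ¬ LiftsOver ratMk (⨆ j, ⨆ _ : j < i, B j) (B i) := hiE
        unfold LiftsOver at hno
        push Not at hno
        obtain ⟨θ, hθ, hno⟩ := hno
        -- Adding the unliftable `θ` defeats the guess `h0`: a lift `h` agreeing with `h0` on the
        -- earlier union would make `h - h0` lift `θ`.
        refine ⟨ratMk.comp h0 + θ, fun j hj x hx => ?_, fun _ ⟨h, h3, h4⟩ => ?_⟩
        · have hx' : x ∈ ⨆ j, ⨆ _ : j < i, B j :=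
            (le_iSup₂_of_le (f := fun j (_ : j < i) => B j) j hj le_rfl) hx
          rw [AddMonoidHom.add_apply, hθ x hx', add_zero]
          exact h2 x hx'
        · obtain ⟨x, hx, hne⟩ := hno (h - h0) fun x hx => sub_eq_zero.2
            (((h1 x hx _).1 ((h3 x hx _).2 rfl)))
          apply hne
          rw [AddMonoidHom.sub_apply, map_sub, h4 x hx, AddMonoidHom.add_apply]
          exact add_sub_cancel_left _ _
      · exact ⟨f, fun _ _ _ _ => rfl, fun hiE ⟨h, h1, h2⟩ =>
          hi ⟨hiE, h, h1, fun x hx => h2 x (hle i hx)⟩⟩)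
  obtain ⟨g, hg⟩ := hA χ
  let X : Set κ.ord.ToType := Set.range fun a : U => code (a, g a)
  have hBU : ∀ i, (B i : Set A) ⊆ U := fun i => Set.subset_iUnion (fun i => (B i : Set A)) i
  -- At a closure point `i`, all codes of pairs over earlier `B j` lie below `i`, so a correct guess
  -- there is exactly the graph of `g` on the earlier union.
  have hclub := hr.isClub_closurePoints hκ
    (f := fun j => Set.range fun p : B j × ℚ => code (⟨p.1, hBU j p.1.2⟩, p.2)) fun j => by
      refine mk_range_le.trans_lt ?_
      rw [mk_prod]
      simpa using mul_lt_of_lt hκ.le (hBκ j) hκ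
  obtain ⟨i, ⟨hiE, hiX⟩, hi, hic⟩ := hS X hclub
  refine hχ i hiE ⟨g, fun a ha r => ?_, fun x _ => hg x⟩
  obtain ⟨j, hj, haj⟩ := (AddSubgroup.mem_iSup_lt_iff hB hi).1 ha
  have haU : a ∈ U := hBU j haj
  have hlt : ∀ r, code (⟨a, haU⟩, r) < i := fun r => hic j hj _ ⟨(⟨a, haj⟩, r), rfl⟩
  constructor
  · rintro ⟨h, hr⟩
    rw [← hiX] at hr
    obtain ⟨⟨b, hb⟩, hbe⟩ := hr.1
    have := code.injective hbe
    simp only [Prod.mk.injEq, Subtype.mk.injEq] at this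
    obtain ⟨rfl, rfl⟩ := this
    rfl
  · rintro rfl
    exact ⟨haU, hiX ▸ ⟨⟨⟨a, haU⟩, rfl⟩, hlt _⟩⟩

/-- A Whitehead group has, in every regular cardinal with diamonds, a continuous chain of
small subgroups which on a club have only Whitehead small quotients above them. -/
theorem Lifts.exists_chain (hr : κ.IsRegular) (hκ : ℵ₀ < κ)
    (hd : ∀ E : Set κ.ord.ToType, IsStationary E → DiamondPrinciple κ E) (hA : Lifts ratMk A)
    (e : κ.ord.ToType → AddSubgroup A) (he : ∀ i, #(e i) < κ) :
    ∃ F : κ.ord.ToType → AddSubgroup A, Monotone F ∧ (∀ i, #(F i) < κ) ∧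
      (∀ i, ∀ j < i, e j ≤ F i) ∧
      (∀ i, (∀ j < i, ∃ k < i, j < k) → F i ≤ ⨆ j, ⨆ _ : j < i, F j) ∧
      ∃ C, IsClub C ∧ ∀ i ∈ C, ∀ M : AddSubgroup A, #M < κ → LiftsOver ratMk (F i) M := by
  classical
  -- A small witness that lifting over `N` fails, if there is one. As `B i` contains the witness for
  -- `F i`, any failure above `F i` already shows at `B i`.
  let w : AddSubgroup A → AddSubgroup A := fun N =>
    if h : ∃ M : AddSubgroup A, #M < κ ∧ ¬ LiftsOver ratMk N M then h.choose else ⊥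
  have hw : ∀ N, #(w N) < κ := fun N => by
    by_cases h : ∃ M : AddSubgroup A, #M < κ ∧ ¬ LiftsOver ratMk N M
    · simp only [w, dif_pos h]; exact h.choose_spec.1
    · simp only [w, dif_neg h]; exact AddSubgroup.mk_bot_lt hκ
  let F : κ.ord.ToType → AddSubgroup A := WellFoundedLT.fix
    (motive := fun _ : κ.ord.ToType => AddSubgroup A) fun i F =>
      ⨆ j : Set.Iio i, F j j.2 ⊔ e j ⊔ w (F j j.2)
  have hF : ∀ i, F i = ⨆ j : Set.Iio i, (F j ⊔ e j ⊔ w (F j)) := fun i => WellFoundedLT.fix_eq _ i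
  let B : κ.ord.ToType → AddSubgroup A := fun j => F j ⊔ e j ⊔ w (F j)
  have hFB : ∀ i, F i = ⨆ j, ⨆ _ : j < i, B j := fun i => by
    rw [hF i, iSup_subtype]; rfl
  have hBF : ∀ i, ∀ j < i, B j ≤ F i := fun i j hj => by
    rw [hFB i]; exact le_iSup₂_of_le j hj le_rfl
  have hFle : ∀ i, F i ≤ B i := fun i => le_sup_left.trans le_sup_left
  have hFm : Monotone F := fun i j hij => by
    rcases hij.eq_or_lt with rfl | h
    · exact le_rfl
    · exact (hFle i).trans (hBF j i h)
  have hBm : Monotone B := fun i j hij => by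
    rcases hij.eq_or_lt with rfl | h
    · exact le_rfl
    · exact (hBF j i h).trans (hFle j)
  have hBκ' : ∀ i, #(F i) < κ → #(B i) < κ := fun i h =>
    AddSubgroup.mk_sup_lt hκ (AddSubgroup.mk_sup_lt hκ h (he i)) (hw _)
  have hFκ : ∀ i, #(F i) < κ := fun i => by
    induction i using WellFoundedLT.induction with
    | ind i ih =>
      rw [hF i]
      exact AddSubgroup.mk_iSup_lt hr hκ (mk_Iio_toType_lt i) fun j => hBκ' j (ih j j.2)
  refine ⟨F, hFm, hFκ, fun i j hj => (le_sup_right.trans le_sup_left).trans (hBF i j hj),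
    fun i hi => ?_, ?_⟩
  · rw [hFB i]
    refine iSup₂_le fun j hj => ?_
    obtain ⟨k, hk, hjk⟩ := hi j hj
    exact (hBF k j hjk).trans (le_iSup₂_of_le k hk le_rfl)
  · have hns := hA.not_isStationary hr hκ hd hBm fun i => hBκ' i (hFκ i)
    rw [not_isStationary_iff] at hns
    obtain ⟨C, hC, hdisj⟩ := hns
    refine ⟨C, hC, fun i hi M hM => ?_⟩
    by_contra hcon
    refine hdisj.le_bot ⟨fun hl => ?_, hi⟩
    rw [← hFB i] at hl
    have h : ∃ M : AddSubgroup A, #M < κ ∧ ¬ LiftsOver ratMk (F i) M := ⟨M, hM, hcon⟩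
    refine h.choose_spec.2 (hl.mono ?_)
    have : w (F i) = h.choose := dif_pos h
    rw [← this]
    exact le_sup_right

end Diamond

/-! ### Hill maps -/

section HillMaps

variable {A : Type u} [AddCommGroup A]

/-- `H` assigns small subgroups to elements such that `M` modulo `N` and any subgroup closed
under `H` is a Whitehead group. -/
def IsHillMap (N M : AddSubgroup A) (H : A → AddSubgroup A) : Prop :=
  (∀ a, #(H a) ≤ ℵ₁) ∧ ∀ L : AddSubgroup A,
    (∀ a ∈ L, a ∈ M → a ∉ N → H a ≤ L) → LiftsOver ratMk (N ⊔ L ⊓ M) M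

/-- A group with a Hill map. -/
def HasHillMap (A : Type u) [AddCommGroup A] : Prop :=
  ∃ H : A → AddSubgroup A, (∀ a, #(H a) ≤ ℵ₁) ∧
    ∀ L : AddSubgroup A, (∀ a ∈ L, a ≠ 0 → H a ≤ L) → LiftsOver ratMk L ⊤

/-- Values in the quotient are pulled back by generating with representatives `σ`; a subgroup closed
under the result has closed image in the quotient. -/
theorem HasHillMap.exists_isHillMap {N M : AddSubgroup A} (hN : N ≤ M)
    (h : HasHillMap (M ⧸ N.addSubgroupOf M)) : ∃ H, IsHillMap N M H := by
  classical
  obtain ⟨H, hH1, hH2⟩ := h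
  let π : M →+ M ⧸ N.addSubgroupOf M := QuotientAddGroup.mk' _
  have hker : ∀ x : M, π x = 0 ↔ (x : A) ∈ N := fun x => QuotientAddGroup.eq_zero_iff x
  have hπ : Function.Surjective π := QuotientAddGroup.mk'_surjective _
  choose σ hσ using id hπ
  refine ⟨fun a => if h : a ∈ M then
    AddSubgroup.closure ((fun y => (σ y : A)) '' (H (π ⟨a, h⟩) : Set _)) else ⊥, fun a => ?_,
    fun L hL => ?_⟩
  · dsimp only
    split_ifs with h
    · exact AddSubgroup.mk_closure_le_of_le aleph0_lt_aleph_one.le (mk_image_le.trans (hH1 _))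
    · exact (AddSubgroup.mk_bot_lt aleph0_lt_aleph_one).le
  · refine LiftsOver.of_surjective baer_rat π hπ
      (hH2 ((L.addSubgroupOf M).map π) ?_) (sup_le hN inf_le_right) fun x => ?_
    · rintro _ ⟨x, hx, rfl⟩ hne y hy
      have hxL : (x : A) ∈ L := hx
      have := hL x hxL x.2 fun hxN => hne ((hker x).2 hxN)
      simp only [dif_pos x.2] at this
      exact ⟨σ y, this (AddSubgroup.subset_closure ⟨y, hy, rfl⟩), hσ y⟩
    · constructor
      · intro hx
        obtain ⟨n, hn, l, hl, e⟩ := AddSubgroup.mem_sup.1 hx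
        refine ⟨⟨l, hl.2⟩, hl.1, ?_⟩
        rw [eq_comm, ← sub_eq_zero, ← map_sub, hker]
        simpa [← e] using hn
      · rintro ⟨l, hl, e⟩
        rw [eq_comm, ← sub_eq_zero, ← map_sub, hker] at e
        exact AddSubgroup.mem_sup.2 ⟨_, e, l, ⟨hl, l.2⟩, by simp⟩

/-- Eklof's lemma modulo `L`: closure under the Hill map of each level makes that level's quotient
lift. -/
theorem LiftsOver.iSup_of_isHillMap {ι : Type*} [LinearOrder ι] [WellFoundedLT ι]
    {F : ι → AddSubgroup A} (hF : Monotone F) {H : ι → A → AddSubgroup A}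
    (hH : ∀ i, IsHillMap (⨆ j, ⨆ _ : j < i, F j) (F i) (H i)) {L : AddSubgroup A}
    (hL : ∀ i, ∀ a ∈ L, a ∈ F i → a ∉ ⨆ j, ⨆ _ : j < i, F j → H i a ≤ L) :
    LiftsOver ratMk L (⨆ i, F i) :=
  LiftsOver.iSup baer_rat hF fun i => LiftsOver.sup_of_sup_inf baer_rat
    (iSup₂_le fun _ hj => hF hj.le) ((hH i).2 L (hL i))

theorem HasHillMap.of_chain {ι : Type*} [LinearOrder ι] [WellFoundedLT ι]
    {F : ι → AddSubgroup A} (hF : Monotone F) (htop : ⨆ i, F i = ⊤)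
    (hH : ∀ i, ∃ H, IsHillMap (⨆ j, ⨆ _ : j < i, F j) (F i) H) : HasHillMap A := by
  classical
  choose H hH using hH
  refine ⟨fun a => if h : ∃ i, a ∈ F i ∧ a ∉ ⨆ j, ⨆ _ : j < i, F j then H h.choose a else ⊥,
    fun a => ?_, fun L hL => ?_⟩
  · dsimp only
    split_ifs with h
    · exact (hH _).1 a
    · exact (AddSubgroup.mk_bot_lt aleph0_lt_aleph_one).le
  · rw [← htop]
    refine LiftsOver.iSup_of_isHillMap hF hH fun i a ha hai hai' => ?_
    have h : ∃ i, a ∈ F i ∧ a ∉ ⨆ j, ⨆ _ : j < i, F j := ⟨i, hai, hai'⟩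
    -- The level at which `a` first appears is unique, so the chosen index is `i`.
    have key : ∀ i j, a ∈ F i → a ∉ ⨆ k, ⨆ _ : k < j, F k → j ≤ i := fun i j h1 h2 =>
      not_lt.1 fun hij => h2 ((le_iSup₂_of_le (f := fun k (_ : k < j) => F k) i hij le_rfl) h1)
    have e : h.choose = i := le_antisymm (key _ _ hai h.choose_spec.2)
      (key _ _ h.choose_spec.1 hai')
    have := hL a ha fun h0 => hai' (h0 ▸ zero_mem _)
    simp only [dif_pos h] at this
    rwa [e] at this

/-- With constant value `⊤`, only the zero subgroup and the whole group are closed. -/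
theorem Lifts.hasHillMap_of_le (hA : Lifts ratMk A) (hcard : #A ≤ ℵ₁) : HasHillMap A := by
  refine ⟨fun _ => ⊤, fun _ => (mk_le_of_injective Subtype.val_injective).trans hcard,
    fun L hL => ?_⟩
  by_cases h : ∃ a ∈ L, a ≠ 0
  · obtain ⟨a, ha, h0⟩ := h
    exact LiftsOver.of_le (hL a ha h0)
  · push Not at h
    rw [show L = ⊥ from (AddSubgroup.eq_bot_iff_forall L).2 h]
    exact hA.liftsOver_bot ⊤

end HillMaps

/-! ### Filtrations and strong subgroups -/

section Filtrations

/-- `A` is the union of a chain of smaller subgroups with Whitehead quotients. -/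
def HasFiltration (A : Type u) [AddCommGroup A] : Prop :=
  ∃ (ι : Type u) (_ : LinearOrder ι) (_ : WellFoundedLT ι) (F : ι → AddSubgroup A),
    Monotone F ∧ ⨆ i, F i = ⊤ ∧ (∀ i, #(F i) < #A) ∧
      ∀ i, LiftsOver ratMk (⨆ j, ⨆ _ : j < i, F j) (F i)

variable {A : Type u} [AddCommGroup A]

theorem Lifts.hasFiltration_of_isRegular (hr : (#A).IsRegular) (hA1 : ℵ₀ < #A)
    (hd : ∀ E : Set (#A).ord.ToType, IsStationary E → DiamondPrinciple (#A) E)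
    (hA : Lifts ratMk A) : HasFiltration A := by
  obtain ⟨enum⟩ := Cardinal.eq.1 (mk_ord_toType #A)
  obtain ⟨F, hF, hFA, heF, hlim, C, hC, hCF⟩ := hA.exists_chain hr hA1 hd
    (fun i => AddSubgroup.closure {enum i})
    (fun i => AddSubgroup.mk_closure_lt hA1 (by
      rw [mk_singleton]; exact one_lt_aleph0.trans hA1))
  refine ⟨C, inferInstance, inferInstance, fun i => F i, fun i j h => hF h, ?_,
    fun i => hFA i, fun i => ?_⟩
  · rw [eq_top_iff]
    intro a _
    obtain ⟨b, hb⟩ := hr.exists_forall_lt (s := {enum.symm a}) (by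
      rw [mk_singleton]; exact one_lt_aleph0.trans hA1)
    obtain ⟨c, hc, hbc⟩ := hC.isCofinal b
    refine le_iSup (fun i : C => F i) ⟨c, hc⟩ (heF c (enum.symm a)
      ((hb _ rfl).trans_le hbc) (AddSubgroup.subset_closure ?_))
    simp
  · refine LiftsOver.of_continuous (F := fun i : C => F i) (fun i j h => hF h) i ?_
      (hA.liftsOver_bot _) fun j hj => hCF j j.2 _ (hFA i)
    rintro ⟨j, hj⟩ hl
    -- A limit within `C` is a limit of `C` in the whole cardinal: otherwise the supremum of the
    -- earlier members would be a last member of `C` before `i`.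
    have hlub : ∀ x < (i : (#A).ord.ToType), ∃ k : C, k < i ∧ x < k := by
      by_contra! hcon
      obtain ⟨x, hx, hxk⟩ := hcon
      obtain ⟨c, hc1, hc2⟩ := (wellFounded_lt (α := (#A).ord.ToType)).has_min
        (upperBounds {y : (#A).ord.ToType | ∃ k : C, k < i ∧ y = k}) ⟨x, by rintro _ ⟨k, hk, rfl⟩; exact hxk k hk⟩
      have hc : IsLUB {y : (#A).ord.ToType | ∃ k : C, k < i ∧ y = k} c := ⟨hc1, fun x hx => not_lt.1 (hc2 x hx)⟩
      have hcC : c ∈ C := hC.isLUB_mem (t := {y : (#A).ord.ToType | ∃ k : C, k < i ∧ y = k})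
        (by rintro _ ⟨k, -, rfl⟩; exact k.2) ⟨j, j, hj, rfl⟩ hc
      have hci : c < i := (hc.2 (by rintro _ ⟨k, hk, rfl⟩; exact hxk k hk)).trans_lt hx
      obtain ⟨k, hk, hck⟩ := hl ⟨c, hcC⟩ hci
      exact (hc.1 ⟨k, hk, rfl⟩).not_gt hck
    refine (hlim i fun x hx => ?_).trans (iSup₂_le fun x hx => ?_)
    · obtain ⟨k, hk, hxk⟩ := hlub x hx
      exact ⟨k, hk, hxk⟩
    · obtain ⟨k, hk, hxk⟩ := hlub x hx
      exact le_iSup₂_of_le (f := fun (j : C) (_ : j < i) => F j) k hk (hF hxk.le)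

/-- Take a member, on the club, of a chain of length κ⁺ whose later members all contain `N`. -/
theorem Lifts.exists_strong_subgroup {κ : Cardinal.{u}} (hκ : ℵ₁ ≤ κ)
    (hd : ∀ E : Set (Order.succ κ).ord.ToType, IsStationary E → DiamondPrinciple (Order.succ κ) E)
    (hA : Lifts ratMk A) {N : AddSubgroup A} (hN : #N ≤ κ) :
    ∃ N', N ≤ N' ∧ #N' ≤ κ ∧ ∀ M : AddSubgroup A, #M ≤ κ → LiftsOver ratMk N' M := by
  have hκ0 : ℵ₀ ≤ κ := aleph0_lt_aleph_one.le.trans hκ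
  have hr : (Order.succ κ).IsRegular := isRegular_succ hκ0
  have hκ1 : ℵ₀ < Order.succ κ := Order.lt_succ_iff.2 hκ0
  obtain ⟨F, hF, hFA, heF, -, C, hC, hCF⟩ := hA.exists_chain hr hκ1 hd
    (fun _ => N) (fun _ => Order.lt_succ_iff.2 hN)
  obtain ⟨a, -⟩ := hr.exists_forall_lt (s := ∅) (by
    rw [mk_eq_zero]; exact hr.pos)
  obtain ⟨b, hb⟩ := hr.exists_forall_lt (s := {a}) (by
    rw [mk_singleton]; exact one_lt_aleph0.trans hκ1)
  obtain ⟨c, hc, hbc⟩ := hC.isCofinal b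
  exact ⟨F c, heF c a ((hb a rfl).trans_le hbc), Order.lt_succ_iff.1 (hFA c),
    fun M hM => hCF c hc M (Order.lt_succ_iff.2 hM)⟩

end Filtrations

/-! ### Ranks and cofinal sequences -/

section SingularCardinals

/-- A set of size at most `κ` has a rank function below `κ` with small initial segments. -/
theorem Cardinal.exists_rank {N : Type u} {κ : Cardinal.{u}} (hN : #N ≤ κ) :
    ∃ e : N → Cardinal.{u}, (∀ a, e a < κ) ∧ ∀ c, #{a | e a < c} ≤ c := by
  rw [← mk_ord_toType κ] at hN
  obtain ⟨i⟩ := Cardinal.le_def _ _ |>.1 hN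
  refine ⟨fun a => (Ordinal.ToType.toOrd (i a)).1.card,
    fun a => lt_ord.1 (Ordinal.ToType.toOrd (i a)).2, fun c => ?_⟩
  conv_rhs => rw [← mk_ord_toType c]
  refine mk_le_of_injective (f := fun a => Ordinal.ToType.mk
    ⟨(Ordinal.ToType.toOrd (i a.1)).1, lt_ord.2 a.2⟩) fun a b hab => ?_
  have := congrArg Subtype.val (Ordinal.ToType.mk.injective hab)
  exact Subtype.ext (i.injective (Ordinal.ToType.mk.symm.injective
    (Subtype.ext this)))

/-- A continuous cofinal sequence of cardinals below a singular cardinal. -/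
theorem Cardinal.IsSingular.exists_continuous_cofinal {c : Cardinal.{u}} (hc : c.IsSingular)
    (hc1 : ℵ₁ < c) : ∃ (V : Type u) (_ : LinearOrder V) (_ : WellFoundedLT V)
      (k : V → Cardinal.{u}), Monotone k ∧ (∀ v, k v < c) ∧ (∀ v, ℵ₁ ≤ k v) ∧ (∀ v, #V ≤ k v) ∧
        (∀ d < c, ∃ v, d < k v) ∧
        ∀ v, (∃ w, w < v) → (∀ w < v, ∃ x < v, w < x) → ∀ d < k v, ∃ w < v, d < k w := by
  have hμ : ℵ₀ ≤ c.ord.cof :=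
    Ordinal.aleph0_le_cof_iff.2 (Ordinal.one_lt_cof_iff.2 (isSuccLimit_ord hc.aleph0_le))
  obtain ⟨s, hs, hsc⟩ := Order.exists_cof_eq (α := c.ord.ToType)
  rw [Ordinal.cof_toType] at hsc
  let V := c.ord.cof.ord.ToType
  have hV : #V = c.ord.cof := mk_ord_toType _
  obtain ⟨φ⟩ := Cardinal.eq.1 (hV.trans hsc.symm)
  let f : V → Cardinal.{u} := fun v => (Ordinal.ToType.toOrd (φ v).1).1.card
  have hfc : ∀ v, f v < c := fun v => lt_ord.1 (Ordinal.ToType.toOrd (φ v).1).2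
  have hf : ∀ d < c, ∃ v, d < f v := fun d hd => by
    have hd' : Order.succ d < c := hc.isSuccLimit.succ_lt hd
    obtain ⟨y, hy, hxy⟩ := hs (Ordinal.ToType.mk ⟨(Order.succ d).ord, ord_lt_ord.2 hd'⟩)
    refine ⟨φ.symm ⟨y, hy⟩, (Order.lt_succ d).trans_le ?_⟩
    have h := Ordinal.ToType.mk.symm.monotone hxy
    rw [OrderIso.symm_apply_apply] at h
    simpa [f] using Ordinal.card_le_card h
  have hmax : NoMaxOrder V := noMaxOrder hμ
  have hb : ∀ v : V, BddAbove (Set.range fun w : Set.Iio v => f w) := fun v => bddAbove_of_small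
  -- Only indices strictly below `v` enter the supremum, which gives continuity at limits; `f` need
  -- not be monotone.
  let k : V → Cardinal.{u} := fun v => max (max c.ord.cof ℵ₁) (⨆ w : Set.Iio v, f w)
  have hkw : ∀ v, ∀ w < v, f w ≤ k v := fun v w hw =>
    (le_ciSup (hb v) ⟨w, hw⟩).trans (le_max_right _ _)
  refine ⟨V, inferInstance, inferInstance, k, fun v w hvw => ?_, fun v => ?_, fun v => ?_,
    fun v => ?_, fun d hd => ?_, fun v hv hlim d hd => ?_⟩
  · exact max_le (le_max_left _ _) (ciSup_le' fun x => hkw w x (x.2.trans_le hvw))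
  · refine max_lt (max_lt hc.cof_ord_lt hc1) (Cardinal.iSup_lt_of_lt_cof_ord ?_ fun w => hfc w)
    exact mk_Iio_toType_lt v
  · exact (le_max_right _ _).trans (le_max_left _ _)
  · exact hV.le.trans ((le_max_left _ _).trans (le_max_left _ _))
  · obtain ⟨v, hv⟩ := hf d hd
    obtain ⟨w, hw⟩ := exists_gt v
    exact ⟨w, hv.trans_le (hkw w v hw)⟩
  · rcases lt_max_iff.1 hd with h | h
    · obtain ⟨w, hw⟩ := hv
      exact ⟨w, hw, h.trans_le (le_max_left _ _)⟩
    · have : Nonempty (Set.Iio v) := ⟨⟨hv.choose, hv.choose_spec⟩⟩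
      obtain ⟨w, hw⟩ := exists_lt_of_lt_ciSup h
      obtain ⟨x, hx, hwx⟩ := hlim w w.2
      exact ⟨x, hx, hw.trans_le (hkw x w hwx)⟩

end SingularCardinals

/-- Diamonds hold at all stationary subsets of all regular cardinals above `ℵ₁`. -/
def DiamondsAboveAlephOne : Prop :=
  ∀ κ : Cardinal.{u}, κ.IsRegular → ℵ₁ < κ →
    ∀ E : Set κ.ord.ToType, IsStationary E → DiamondPrinciple κ E

/-! ### Singular compactness -/

section SingularStep

variable {A : Type u} [AddCommGroup A]

theorem AddSubgroup.mk_iSup_nat_le {κ : Cardinal.{u}} (hκ : ℵ₀ ≤ κ) {D : ℕ → AddSubgroup A}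
    (hD : ∀ n, #(D n) ≤ κ) : #(⨆ n, D n : AddSubgroup A) ≤ κ := by
  rw [← Equiv.ulift.{u}.iSup_comp]
  exact AddSubgroup.mk_iSup_le hκ (mk_le_aleph0.trans hκ) fun n => hD _

theorem mk_quotient_addSubgroupOf_le (N M : AddSubgroup A) : #(M ⧸ N.addSubgroupOf M) ≤ #M :=
  mk_le_of_surjective (QuotientAddGroup.mk'_surjective _)

/-- Shelah's singular compactness, for filtrations by Whitehead groups. -/
theorem Lifts.hasFiltration_of_isSingular (hdiamond : DiamondsAboveAlephOne.{u})
    (hA : Lifts ratMk A) (hs : (#A).IsSingular) (hA1 : ℵ₁ < #A)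
    (ih : ∀ (X : Type u) [AddCommGroup X], #X < #A → Lifts ratMk X → HasHillMap X) :
    HasFiltration A := by
  classical
  obtain ⟨V, _, _, k, hk, hkA, hk1, hkV, hkcof, hkcont⟩ := hs.exists_continuous_cofinal hA1
  have hk0 : ∀ v, ℵ₀ ≤ k v := fun v => aleph0_lt_aleph_one.le.trans (hk1 v)
  have hill : ∀ N M : AddSubgroup A, ∃ H : A → AddSubgroup A, (∀ a, #(H a) ≤ ℵ₁) ∧
      ((∃ H, IsHillMap N M H) → IsHillMap N M H) := fun N M => by
    by_cases h : ∃ H, IsHillMap N M H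
    · exact ⟨h.choose, h.choose_spec.1, fun _ => h.choose_spec⟩
    · exact ⟨fun _ => ⊥, fun _ => (AddSubgroup.mk_bot_lt aleph0_lt_aleph_one).le,
        fun h' => (h h').elim⟩
  choose hill hill1 hill2 using hill
  obtain ⟨eA, heA, heA'⟩ := Cardinal.exists_rank (le_refl #A)
  -- One stage: strong subgroups of size at most `k v`, with the accumulated Hill maps under which
  -- later stages must be closed.
  let State := {s : (V → AddSubgroup A) × (V → A → AddSubgroup A) //
    (∀ v, #(s.1 v) ≤ k v) ∧ (∀ v, ∀ M : AddSubgroup A, #M ≤ k v → LiftsOver ratMk (s.1 v) M) ∧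
      ∀ v a, #(s.2 v a) ≤ ℵ₁}
  have step : ∀ s : State, ∃ t : State, (∀ v, s.1.1 v ≤ t.1.1 v) ∧
      (∀ v a, t.1.2 v a = s.1.2 v a ⊔ hill (s.1.1 v) (t.1.1 v) a) ∧
      (∀ v, ∀ a ∈ s.1.1 v, ∀ w, s.1.2 w a ≤ t.1.1 v) ∧
      (∀ w, ∃ e : A → Cardinal.{u}, (∀ a ∈ s.1.1 w, e a < k w) ∧
        ∀ v, ∀ a ∈ s.1.1 w, e a < k v → a ∈ t.1.1 v) ∧
      ∀ v a, eA a < k v → a ∈ t.1.1 v := by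
    rintro ⟨⟨N, G⟩, hN, hNM, hG⟩
    dsimp only at hN hNM hG
    choose e he he' using fun w => Cardinal.exists_rank (hN w)
    -- Besides the old subgroup, `T v` takes in Hill values for every index of `V`, all elements of
    -- rank below `k v` in each `N w` (for monotonicity and continuity), and those of `A` (for
    -- exhaustion).
    let T : V → AddSubgroup A := fun v => N v ⊔ (⨆ p : N v × V, G p.2 p.1) ⊔
      AddSubgroup.closure ((⋃ w, Subtype.val '' {a : N w | e w a < k v}) ∪ {a | eA a < k v})
    have hT : ∀ v, #(T v) ≤ k v := fun v => by
      refine AddSubgroup.mk_sup_le (hk0 v) (AddSubgroup.mk_sup_le (hk0 v) (hN v) ?_) ?_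
      · refine AddSubgroup.mk_iSup_le (hk0 v) ?_ fun p => (hG _ _).trans (hk1 v)
        rw [mk_prod, lift_id, lift_id]
        exact mul_le_of_le (hk0 v) (hN v) (hkV v)
      · refine AddSubgroup.mk_closure_le_of_le (hk0 v) <| (mk_union_le _ _).trans <|
          add_le_of_le (hk0 v) ?_ (heA' _)
        refine mk_iUnion_le_sum_mk.trans <| (Cardinal.sum_le_sum _ (fun _ => k v) fun w =>
          mk_image_le.trans (he' w _)).trans ?_
        simpa using mul_le_of_le (hk0 v) (hkV v) le_rfl
    choose N' hTN hN' hNM' using fun v => hA.exists_strong_subgroup (hk1 v)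
      (hdiamond _ (isRegular_succ (hk0 v)) (Order.lt_succ_iff.2 (hk1 v))) (hT v)
    refine ⟨⟨⟨N', fun v a => G v a ⊔ hill (N v) (N' v) a⟩, hN', hNM', fun v a =>
      AddSubgroup.mk_sup_le aleph0_lt_aleph_one.le (hG v a) (hill1 _ _ _)⟩,
      fun v => (le_sup_left.trans le_sup_left).trans (hTN v), fun v a => rfl,
      fun v a ha w => ?_, fun w => ?_, fun v a ha => ?_⟩
    · exact ((le_iSup (fun p : N v × V => G p.2 p.1) (⟨a, ha⟩, w)).trans
        (le_sup_right.trans le_sup_left)).trans (hTN v)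
    · refine ⟨fun a => if h : a ∈ N w then e w ⟨a, h⟩ else 0, fun a ha => ?_, fun v a ha hav => ?_⟩
      · simp only [dif_pos (show a ∈ N w from ha)]
        exact he w _
      · simp only [dif_pos (show a ∈ N w from ha)] at hav
        exact hTN v ((le_sup_right : _ ≤ T v) (AddSubgroup.subset_closure
          (Or.inl (Set.mem_iUnion.2 ⟨w, ⟨a, ha⟩, hav, rfl⟩))))
    · exact hTN v ((le_sup_right : _ ≤ T v) (AddSubgroup.subset_closure (Or.inr ha)))
  choose next hnext1 hnext2 hnext3 hnext4 hnext5 using step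
  let s0 : State := ⟨⟨fun _ => ⊥, fun _ _ => ⊥⟩,
    fun v => (AddSubgroup.mk_bot_lt aleph0_lt_aleph_one).le.trans (hk1 v),
    fun v M _ => hA.liftsOver_bot M, fun _ _ => (AddSubgroup.mk_bot_lt aleph0_lt_aleph_one).le⟩
  let s : ℕ → State := fun n => next^[n] s0
  have hs' : ∀ n, s (n + 1) = next (s n) := fun n => Function.iterate_succ_apply' next n s0
  let N : ℕ → V → AddSubgroup A := fun n => (s n).1.1
  let G : ℕ → V → A → AddSubgroup A := fun n => (s n).1.2
  have hN1 : ∀ n v, N n v ≤ N (n + 1) v := fun n v => by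
    simpa only [N, hs'] using hnext1 (s n) v
  have hG1 : ∀ n v a, G (n + 1) v a = G n v a ⊔ hill (N n v) (N (n + 1) v) a := fun n v a => by
    simpa only [N, G, hs'] using hnext2 (s n) v a
  have hNG : ∀ n v, ∀ a ∈ N n v, ∀ w, G n w a ≤ N (n + 1) v := fun n v a ha w => by
    simpa only [N, G, hs'] using hnext3 (s n) v a ha w
  have hrank : ∀ n w, ∃ e : A → Cardinal.{u}, (∀ a ∈ N n w, e a < k w) ∧
        ∀ v, ∀ a ∈ N n w, e a < k v → a ∈ N (n + 1) v := fun n w => by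
    simpa only [N, hs'] using hnext4 (s n) w
  have hexh : ∀ v a, eA a < k v → a ∈ N 1 v := fun v a ha => hnext5 s0 v a ha
  have hNmono : ∀ v, Monotone fun n => N n v := fun v => monotone_nat_of_le_succ fun n => hN1 n v
  have hGmono : ∀ v a, Monotone fun n => G n v a := fun v a =>
    monotone_nat_of_le_succ fun n => (hG1 n v a).symm ▸ le_sup_left
  have hmem : ∀ v a, a ∈ ⨆ n, N n v ↔ ∃ n, a ∈ N n v := fun v a =>
    AddSubgroup.mem_iSup_of_directed (hNmono v).directed_le
  have hcard : ∀ v, #(⨆ n, N n v : AddSubgroup A) < #A := fun v =>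
    (AddSubgroup.mk_iSup_nat_le (hk0 v) fun n => (s n).2.1 v).trans_lt (hkA v)
  have hmono : Monotone fun v => ⨆ n, N n v := fun v w hvw a ha => by
    obtain ⟨n, hn⟩ := (hmem v a).1 ha
    obtain ⟨e, he, he'⟩ := hrank n v
    exact (hmem w a).2 ⟨n + 1, he' w a hn ((he a hn).trans_le (hk hvw))⟩
  have hprev : ∀ v n, ⨆ j, ⨆ _ : j < n + 1, N j v = N n v := fun v n =>
    le_antisymm (iSup₂_le fun j hj => hNmono v (Nat.lt_succ_iff.1 hj))
      (le_iSup₂_of_le n (Nat.lt_succ_self n) le_rfl)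
  have hhill : ∀ v n, IsHillMap (N n v) (N (n + 1) v) (hill (N n v) (N (n + 1) v)) := fun v n =>
    hill2 _ _ <| HasHillMap.exists_isHillMap (hN1 n v) <|
      ih _ ((mk_quotient_addSubgroupOf_le _ _).trans_lt (((s (n + 1)).2.1 v).trans_lt (hkA v)))
        (LiftsOver.lifts_quotient baer_ratModInt ((s n).2.2.1 v _ ((s (n + 1)).2.1 v)))
  -- The union over stages at `v` need not be strong, but it is closed under the Hill maps of the
  -- ω-chain at `w`.
  have hlift : ∀ v w, LiftsOver ratMk (⨆ n, N n v) (⨆ n, N n w) := fun v w => by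
    refine LiftsOver.iSup_of_isHillMap (hNmono w)
      (H := fun n => Nat.casesOn n (fun _ => ⊥) fun n => hill (N n w) (N (n + 1) w))
      (fun n => ?_) fun n a ha han han' => ?_
    · cases n with
      | zero =>
        exact ⟨fun _ => (AddSubgroup.mk_bot_lt aleph0_lt_aleph_one).le, fun L _ =>
          LiftsOver.of_le (bot_le : N 0 w ≤ _)⟩
      | succ n =>
        rw [hprev]
        exact hhill w n
    · cases n with
      | zero => exact bot_le
      | succ n =>
        obtain ⟨m, hm⟩ := (hmem v a).1 ha
        have h1 : hill (N n w) (N (n + 1) w) a ≤ G (n + 1) w a := (hG1 n w a).symm ▸ le_sup_right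
        exact (h1.trans (hGmono w a (le_max_right m (n + 1)))).trans <|
          (hNG _ v a (hNmono v (le_max_left m (n + 1)) hm) w).trans
            (le_iSup (fun n => N n v) _)
  refine ⟨V, inferInstance, inferInstance, fun v => ⨆ n, N n v, hmono, ?_, hcard, fun v =>
    LiftsOver.of_continuous hmono v (fun h1 h2 a ha => ?_) (hA.liftsOver_bot _)
      fun w _ => hlift w v⟩
  · rw [eq_top_iff]
    intro a _
    obtain ⟨v, hv⟩ := hkcof _ (heA a)
    exact le_iSup (fun v => ⨆ n, N n v) v ((hmem v a).2 ⟨1, hexh v a hv⟩)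
  -- The rank of `a` is below `k v`, hence below `k w` for some `w < v`, so the next stage at `w`
  -- contains `a`.
  · obtain ⟨n, hn⟩ := (hmem v a).1 ha
    obtain ⟨e, he, he'⟩ := hrank n v
    obtain ⟨w, hw, hlt⟩ := hkcont v h1 h2 _ (he a hn)
    exact le_iSup₂_of_le (f := fun w (_ : w < v) => ⨆ n, N n w) w hw le_rfl
      ((hmem w a).2 ⟨n + 1, he' w a hn hlt⟩)

end SingularStep

/-! ### Induction on cardinality -/

theorem Lifts.hasFiltration_of_hasHillMap (hdiamond : DiamondsAboveAlephOne.{u}) {A : Type u}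
    [AddCommGroup A] (hA : Lifts ratMk A) (hA1 : ℵ₁ < #A)
    (ih : ∀ (X : Type u) [AddCommGroup X], #X < #A → Lifts ratMk X → HasHillMap X) :
    HasFiltration A := by
  have h0 := aleph0_lt_aleph_one.trans hA1
  rcases isRegular_or_isSingular h0.le with h | h
  · exact hA.hasFiltration_of_isRegular h h0 (hdiamond _ h hA1)
  · exact hA.hasFiltration_of_isSingular hdiamond h hA1 ih

/-- Hill maps on the smaller groups give a filtration of `A`, and Hill maps on its quotients glue to
one on `A`. -/
theorem Lifts.hasHillMap (hdiamond : DiamondsAboveAlephOne.{u}) (A : Type u) [AddCommGroup A]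
    (hA : Lifts ratMk A) : HasHillMap A := by
  induction h : #A using WellFoundedLT.induction generalizing A with
  | ind c ih =>
    subst h
    rcases le_or_gt #A ℵ₁ with h1 | h1
    · exact hA.hasHillMap_of_le h1
    · have ih' : ∀ (X : Type u) [AddCommGroup X], #X < #A → Lifts ratMk X → HasHillMap X :=
        fun X _ hX hl => ih #X hX X hl rfl
      obtain ⟨ι, _, _, F, hF, htop, hcard, hl⟩ := hA.hasFiltration_of_hasHillMap hdiamond h1 ih'
      exact HasHillMap.of_chain hF htop fun i => HasHillMap.exists_isHillMap
        (iSup₂_le fun j hj => hF hj.le) <| ih' _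
          ((mk_quotient_addSubgroupOf_le _ _).trans_lt (hcard i))
          ((hl i).lifts_quotient baer_ratModInt)

/-- Under diamonds, lifting against `q` for all small Whitehead groups implies lifting for all
Whitehead groups. -/
theorem Lifts.of_small (hdiamond : DiamondsAboveAlephOne.{u}) {I J : Type*} [AddCommGroup I]
    [AddCommGroup J] (hI : Module.Baer ℤ I) (q : I →+ J)
    (hsmall : ∀ (X : Type u) [AddCommGroup X], #X ≤ ℵ₁ → Lifts ratMk X → Lifts q X)
    (A : Type u) [AddCommGroup A] (hA : Lifts ratMk A) : Lifts q A := by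
  induction h : #A using WellFoundedLT.induction generalizing A with
  | ind c ih =>
    subst h
    rcases le_or_gt #A ℵ₁ with h1 | h1
    · exact hsmall A h1 hA
    · obtain ⟨ι, _, _, F, hF, htop, hcard, hl⟩ := hA.hasFiltration_of_hasHillMap hdiamond h1
        fun X _ _ hX => hX.hasHillMap hdiamond
      rw [lifts_iff_liftsOver, ← htop]
      refine LiftsOver.iSup hI hF fun i => ?_
      rw [bot_sup_eq]
      exact LiftsOver.of_lifts_quotient hI (iSup₂_le fun j hj => hF hj.le) <|
        ih _ ((mk_quotient_addSubgroupOf_le _ _).trans_lt (hcard i)) _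
          ((hl i).lifts_quotient baer_ratModInt) rfl

/-! ### Ext as a lifting condition -/

section Ext

open Abelian

theorem AddMonoidHom.exists_comp_eq_of_mem_range {X D I : Type*} [AddCommGroup X]
    [AddCommGroup D] [AddCommGroup I] (i : D →+ I) (hi : Function.Injective i) (f : X →+ I)
    (h : ∀ x, f x ∈ i.range) : ∃ g : X →+ D, ∀ x, i (g x) = f x := by
  choose g hg using h
  exact ⟨AddMonoidHom.mk' g fun x y => hi (by rw [map_add, hg, hg, hg, map_add]), hg⟩

/-- `Ext(X, D)` vanishes exactly when maps from `X` lift along an injective resolution of `D`. -/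
theorem extVanishes_iff_lifts {X D I J : Type u} [AddCommGroup X] [AddCommGroup D]
    [AddCommGroup I] [AddCommGroup J] (hI : Module.Baer ℤ I) (i : D →+ I) (q : I →+ J)
    (hi : Function.Injective i) (hq : Function.Surjective q) (hiq : Function.Exact i q) :
    ExtVanishes X D ↔ Lifts q X := by
  let S : ShortComplex (ModuleCat.{u} ℤ) := ShortComplex.mk
    (ModuleCat.ofHom i.toIntLinearMap) (ModuleCat.ofHom q.toIntLinearMap)
    (by ext x; exact hiq.apply_apply_eq_zero x)
  have hS : S.ShortExact := by
    have : Mono S.f := (ModuleCat.mono_iff_injective _).2 hi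
    have : Epi S.g := (ModuleCat.epi_iff_surjective _).2 hq
    refine ⟨(ShortComplex.moduleCat_exact_iff S).2 fun x hx => ?_⟩
    exact (hiq x).1 hx
  have hinj : Injective S.X₂ := Module.injective_object_of_injective_module (inj := hI.injective)
  constructor
  · intro h χ
    have h' : Subsingleton (Ext (ModuleCat.of ℤ X) S.X₁ 1) := h
    obtain ⟨x₂, hx₂⟩ := Ext.covariant_sequence_exact₃ (ModuleCat.of ℤ X) hS
      (Ext.mk₀ (ModuleCat.ofHom χ.toIntLinearMap)) (zero_add 1) (Subsingleton.elim _ _)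
    obtain ⟨g, rfl⟩ := (Ext.mk₀_bijective _ _).2 x₂
    rw [Ext.mk₀_comp_mk₀] at hx₂
    have := (Ext.mk₀_bijective _ _).1 hx₂
    exact ⟨g.hom.toAddMonoidHom, fun x => congrArg (fun f => f.hom x) this⟩
  · intro h
    refine subsingleton_of_forall_eq (0 : Ext (ModuleCat.of ℤ X) S.X₁ 1) fun e => ?_
    obtain ⟨x₃, rfl⟩ := Ext.covariant_sequence_exact₁ (ModuleCat.of ℤ X) hS e
      (Ext.eq_zero_of_injective _) (zero_add 1)
    obtain ⟨χ, rfl⟩ := (Ext.mk₀_bijective _ _).2 x₃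
    obtain ⟨g, hg⟩ := h χ.hom.toAddMonoidHom
    have : χ = ModuleCat.ofHom g.toIntLinearMap ≫ S.g := by
      ext x
      exact (hg x).symm
    rw [this, ← Ext.mk₀_comp_mk₀, Ext.comp_assoc _ _ _ (zero_add 0) (zero_add 1) (by simp),
      hS.comp_extClass, Ext.comp_zero]

theorem Lifts.of_addEquiv {I J X Y : Type*} [AddCommGroup I] [AddCommGroup J] [AddCommGroup X]
    [AddCommGroup Y] {q : I →+ J} (e : X ≃+ Y) (h : Lifts q X) : Lifts q Y := fun χ =>
  let ⟨g, hg⟩ := h (χ.comp e.toAddMonoidHom)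
  ⟨g.comp e.symm.toAddMonoidHom, fun y => (hg (e.symm y)).trans (by simp)⟩

theorem exact_intCast_ratMk : Function.Exact (Int.castAddHom ℚ) ratMk := fun x =>
  QuotientAddGroup.eq_zero_iff x

theorem isWGroup_iff_lifts {A : Type u} [AddCommGroup A] : IsWGroup A ↔ Lifts ratMk A := by
  let i : ULift.{u} ℤ →+ ULift.{u} ℚ := AddEquiv.ulift.symm.toAddMonoidHom.comp
    ((Int.castAddHom ℚ).comp AddEquiv.ulift.toAddMonoidHom)
  let q : ULift.{u} ℚ →+ ULift.{u} RatModInt := AddEquiv.ulift.symm.toAddMonoidHom.comp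
    (ratMk.comp AddEquiv.ulift.toAddMonoidHom)
  have hq : ∀ x, q x = ULift.up (ratMk x.down) := fun _ => rfl
  have hbaer : Module.Baer ℤ (ULift.{u} ℚ) :=
    Module.Baer.of_equiv ULift.moduleEquiv.symm baer_rat
  refine (extVanishes_iff_lifts hbaer i q ?_ ?_ ?_).trans ⟨fun h χ => ?_, fun h χ => ?_⟩
  · rintro ⟨x⟩ ⟨y⟩ h
    have := congrArg ULift.down h
    exact congrArg ULift.up (Int.cast_injective (α := ℚ) this)
  · rintro ⟨y⟩
    obtain ⟨x, rfl⟩ := QuotientAddGroup.mk'_surjective _ y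
    exact ⟨ULift.up x, rfl⟩
  · rintro ⟨x⟩
    rw [hq, ULift.ext_iff]
    refine (exact_intCast_ratMk x).trans ⟨?_, ?_⟩
    · rintro ⟨n, rfl⟩
      exact ⟨ULift.up n, rfl⟩
    · rintro ⟨n, hn⟩
      exact ⟨n.down, congrArg ULift.down hn⟩
  · obtain ⟨g, hg⟩ := h (AddEquiv.ulift.symm.toAddMonoidHom.comp χ)
    exact ⟨(AddEquiv.ulift : ULift.{u} ℚ ≃+ ℚ).toAddMonoidHom.comp g, fun x => congrArg ULift.down (hg x)⟩
  · obtain ⟨g, hg⟩ := h (AddEquiv.ulift.toAddMonoidHom.comp χ)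
    exact ⟨(AddEquiv.ulift : ULift.{u} ℚ ≃+ ℚ).symm.toAddMonoidHom.comp g, fun x => ULift.ext _ _ (hg x)⟩

end Ext

/-! ### Duals and tensor products -/

section Duals

variable {A B : Type u} [AddCommGroup A] [AddCommGroup B]

/-- Composition with `ℚ → ℚ / ℤ`, whose kernel is the dual of `B`. -/
abbrev homRatMk (B : Type u) [AddCommGroup B] : (B →+ ℚ) →+ (B →+ RatModInt) :=
  AddMonoidHom.compHom ratMk

theorem baer_hom_rat (B : Type u) [AddCommGroup B] : Module.Baer ℤ (B →+ ℚ) :=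
  letI : DivisibleBy (B →+ ℚ) ℤ :=
    { div := fun f n => (AddMonoidHom.mulLeft (n : ℚ)⁻¹).comp f
      div_zero := fun f => by ext; simp
      div_cancel := fun {n} f hn => by
        ext x
        have : (n : ℚ) ≠ 0 := Int.cast_ne_zero.2 hn
        simp [this] }
  Module.Baer.of_divisible _

theorem lifts_homRatMk_iff : Lifts (homRatMk B) A ↔ Lifts ratMk (A ⊗[ℤ] B) := by
  have curry : ∀ {P : Type} [AddCommGroup P] (χ : A ⊗[ℤ] B →+ P),
      ∃ χ' : A →+ B →+ P, ∀ a b, χ' a b = χ (a ⊗ₜ b) := fun χ =>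
    ⟨AddMonoidHom.mk' (fun a => AddMonoidHom.mk' (fun b => χ (a ⊗ₜ b)) fun b c => by
      rw [TensorProduct.tmul_add, map_add]) fun a c => by
        ext b
        simp [TensorProduct.add_tmul], fun _ _ => rfl⟩
  have uncurry : ∀ {P : Type} [AddCommGroup P] (χ' : A →+ B →+ P),
      ∃ χ : A ⊗[ℤ] B →+ P, ∀ a b, χ (a ⊗ₜ b) = χ' a b := fun χ' =>
    ⟨TensorProduct.liftAddHom χ' fun r a b => by simp, fun _ _ => rfl⟩
  constructor
  · intro h χ
    obtain ⟨χ', hχ⟩ := curry χ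
    obtain ⟨g', hg'⟩ := h χ'
    obtain ⟨g, hg⟩ := uncurry g'
    refine ⟨g, fun x => ?_⟩
    induction x using TensorProduct.induction_on with
    | zero => simp
    | tmul a b =>
      rw [hg, ← hχ, ← hg' a]
      rfl
    | add x y hx hy => rw [map_add, map_add, hx, hy, map_add]
  · intro h χ'
    obtain ⟨χ, hχ⟩ := uncurry χ'
    obtain ⟨g, hg⟩ := h χ
    obtain ⟨g', hg'⟩ := curry g
    refine ⟨g', fun a => AddMonoidHom.ext fun b => ?_⟩
    rw [← hχ, ← hg, ← hg']
    rfl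

/-- That `B` is a W-group is precisely surjectivity of Hom(B, ℚ) → Hom(B, ℚ/ℤ). -/
theorem extVanishes_iff_lifts_homRatMk (hB : Lifts ratMk B) {C : Type u} [AddCommGroup C]
    (e : C ≃+ (B →+ ℤ)) : ExtVanishes A C ↔ Lifts (homRatMk B) A := by
  have hcast : ∀ f : B →+ ℤ, ∀ b, AddMonoidHom.compHom (Int.castAddHom ℚ) f b = (f b : ℚ) :=
    fun _ _ => rfl
  refine extVanishes_iff_lifts (baer_hom_rat B)
    ((AddMonoidHom.compHom (Int.castAddHom ℚ)).comp e.toAddMonoidHom) (homRatMk B) ?_ ?_ ?_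
  · intro x y h
    refine e.injective (AddMonoidHom.ext fun b => Int.cast_injective (α := ℚ) ?_)
    exact DFunLike.congr_fun h b
  · intro χ
    obtain ⟨g, hg⟩ := hB χ
    exact ⟨g, AddMonoidHom.ext hg⟩
  · intro f
    constructor
    · intro hf
      obtain ⟨g, hg⟩ := (Int.castAddHom ℚ).exists_comp_eq_of_mem_range Int.cast_injective f
        fun b => (exact_intCast_ratMk (f b)).1 (DFunLike.congr_fun hf b)
      exact ⟨e.symm g, AddMonoidHom.ext fun b => by simpa using hg b⟩
    · rintro ⟨c, rfl⟩
      exact AddMonoidHom.ext fun b => (exact_intCast_ratMk _).2 ⟨e c b, rfl⟩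

/-- The image of `ψ` is nℤ with n ≠ 0; divide by n. -/
theorem exists_hom_int_eq_one {ψ : B →+ ℤ} (hψ : ψ ≠ 0) : ∃ (φ : B →+ ℤ) (b : B), φ b = 1 := by
  obtain ⟨n, hn⟩ := Int.subgroup_cyclic ψ.range
  have hmem : ∀ x, x ∈ ψ.range ↔ ∃ k : ℤ, k * n = x := fun x => by
    rw [hn, AddSubgroup.mem_closure_singleton]
    simp
  have hn0 : n ≠ 0 := by
    rintro rfl
    refine hψ (AddMonoidHom.ext fun b => ?_)
    obtain ⟨k, hk⟩ := (hmem (ψ b)).1 ⟨b, rfl⟩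
    simpa using hk.symm
  have hinj : Function.Injective (AddMonoidHom.mulRight n) := mul_left_injective₀ hn0
  obtain ⟨φ, hφ⟩ := (AddMonoidHom.mulRight n).exists_comp_eq_of_mem_range hinj ψ
    fun b => (hmem _).1 ⟨b, rfl⟩
  obtain ⟨b, hb⟩ := (hmem n).2 ⟨1, one_mul n⟩
  refine ⟨φ, b, hinj ?_⟩
  rw [hφ, hb]
  simp

/-- Lift a ↦ φ(·)χ(a) and evaluate at an element where φ is 1. -/
theorem Lifts.of_homRatMk (h : Lifts (homRatMk B) A) {ψ : B →+ ℤ} (hψ : ψ ≠ 0) :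
    Lifts ratMk A := by
  obtain ⟨φ, b, hb⟩ := exists_hom_int_eq_one hψ
  intro χ
  obtain ⟨g, hg⟩ := h (AddMonoidHom.mk' (fun a => AddMonoidHom.mk' (fun b => φ b • χ a)
    fun b c => by rw [map_add, add_zsmul]) fun a c => by
      ext b
      simp)
  refine ⟨(AddMonoidHom.eval b).comp g, fun a => (DFunLike.congr_fun (hg a) b).trans ?_⟩
  simp [hb]

end Duals

/-! ### The main theorem -/

theorem theorem3p4
    (diamond : ∀ κ : Cardinal.{u}, κ.IsRegular → ℵ₁ < κ →
      ∀ E : Set κ.ord.ToType, IsStationary E → DiamondPrinciple κ E)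
    (small : ∀ (A B : Type u) [AddCommGroup A] [AddCommGroup B],
      #A ≤ ℵ₁ → #B ≤ ℵ₁ → IsWGroup A → IsWGroup B → IsWGroup (A ⊗[ℤ] B)) :
    (∀ (A B : Type u) [AddCommGroup A] [AddCommGroup B],
      IsWGroup A → IsWGroup B → IsWGroup (A ⊗[ℤ] B)) ∧
    (∀ (C : Type u) [AddCommGroup C] [Nontrivial C], IsWStarGroup C → IsWTestGroup C) := by
  have reduce : ∀ (B : Type u) [AddCommGroup B],
      (∀ (X : Type u) [AddCommGroup X], #X ≤ ℵ₁ → IsWGroup X → IsWGroup (X ⊗[ℤ] B)) →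
      ∀ (A : Type u) [AddCommGroup A], IsWGroup A → IsWGroup (A ⊗[ℤ] B) := fun B _ h A _ hA => by
    rw [isWGroup_iff_lifts] at hA ⊢
    exact lifts_homRatMk_iff.1 <| Lifts.of_small diamond (baer_hom_rat B) _
      (fun X _ hX hX' => lifts_homRatMk_iff.2
        (isWGroup_iff_lifts.1 (h X hX (isWGroup_iff_lifts.2 hX')))) A hA
  have tensor : ∀ (A B : Type u) [AddCommGroup A] [AddCommGroup B],
      IsWGroup A → IsWGroup B → IsWGroup (A ⊗[ℤ] B) := fun A B _ _ hA hB => by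
    -- First shrink the left factor with `B` arbitrary; then, with the small `X` fixed, shrink `B`
    -- and swap the factors.
    refine reduce B (fun X _ hX hXW => ?_) A hA
    have := reduce X (fun Y _ hY hYW => small Y X hY hX hYW hXW) B hB
    rw [isWGroup_iff_lifts] at this ⊢
    exact this.of_addEquiv (TensorProduct.comm ℤ B X).toAddEquiv
  refine ⟨tensor, fun C _ _ ⟨B, _, hB, ⟨e⟩⟩ A _ => ?_⟩
  rw [extVanishes_iff_lifts_homRatMk (isWGroup_iff_lifts.1 hB) e]
  constructor
  · intro hA
    exact lifts_homRatMk_iff.2 (isWGroup_iff_lifts.1 (tensor A B hA hB))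
  · intro h
    obtain ⟨c, hc⟩ := exists_ne (0 : C)
    exact isWGroup_iff_lifts.2 (h.of_homRatMk (e.map_ne_zero_iff.2 hc))
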